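/- Let $K$ be an arbitrary field and let $\lambda=(r,r,\ldots,r)$ be a rectangular partition of $n$, that is, a partition with $d$ equal parts $r$, where $d,r\ge 2$ and $n=dr$. Let $T_\lambda$ be the nilpotent $n\times n$ matrix in Jordan canonical form with blocks of sizes $\lambda_1,\ldots,\lambda_d$: its entries are $1$ in the positions $(j,j+1)$ for $j\in\{1,\ldots,n-1\}\setminus\{\lambda_1,\lambda_1+\lambda_2,\ldots,\lambda_1+\cdots+\lambda_{d-1}\}$, and $0$ elsewhere. It acts on row vectors in $K^n$ from the right. For $0\le\ell\le n$ consider the variety $$\mathrm{Gr}(\ell,n)^{T_\lambda}=\{L\in\mathrm{Gr}(\ell,n)\,:\,L\,T_\lambda\subseteq L\}\subseteq\mathbb{P}^{\binom n\ell-1}$$ of $T_\lambda$-stable $\ell$-dimensional subspaces, embedded by Plücker coordinates. Then $\mathrm{Gr}(\ell,n)^{T_\lambda}$ is irreducible. Precisely: its set of points over the algebraic closure $\overline K$ is irreducible (in particular non-empty) in the Zariski topology of $\mathbb{P}^{\binom n\ell-1}(\overline K)$; and if $K$ is infinite, its set of $K$-rational points is irreducible in the Zariski topology of $\mathbb{P}^{\binom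 n\ell-1}(K)$. -/

import Mathlib

/-! ### Projective space over a field, with its Zariski topology -/

/-- The set of points of the projective space `ℙ(K^σ)` at which all polynomials of `S` vanish.
It is only used for sets `S` of homogeneous polynomials, where vanishing at a point does not depend
on the representative. -/
def projZeroLocus {K σ : Type*} [Field K] (S : Set (MvPolynomial σ K)) :
    Set (Projectivization K (σ → K)) :=
  {x | ∀ f ∈ S, MvPolynomial.eval x.rep f = 0}

/-- Zariski closed subsets of `ℙ(K^σ)`: the zero loci of sets of homogeneous polynomials. -/
def IsZariskiClosed {K σ : Type*} [Field K] (Z : Set (Projectivization K (σ → K))) : Prop :=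
  ∃ S : Set (MvPolynomial σ K), (∀ f ∈ S, ∃ m : ℕ, f.IsHomogeneous m) ∧ Z = projZeroLocus S

theorem isZariskiClosed_union {K σ : Type*} [Field K] {Y Z : Set (Projectivization K (σ → K))}
    (hY : IsZariskiClosed Y) (hZ : IsZariskiClosed Z) : IsZariskiClosed (Y ∪ Z) := by
  obtain ⟨S, hS, rfl⟩ := hY
  obtain ⟨S', hS', rfl⟩ := hZ
  refine ⟨Set.image2 (fun f g => f * g) S S', ?_, ?_⟩
  · rintro _ ⟨f, hf, g, hg, rfl⟩
    obtain ⟨a, ha⟩ := hS f hf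
    obtain ⟨b, hb⟩ := hS' g hg
    exact ⟨a + b, ha.mul hb⟩
  · ext x
    simp only [projZeroLocus, Set.mem_union, Set.mem_ofPred_eq]
    constructor
    · rintro (h | h) _ ⟨f, hf, g, hg, rfl⟩
      · simp [h f hf]
      · simp [h g hg]
    · intro h
      by_contra hc
      push Not at hc
      obtain ⟨⟨f, hf, hf0⟩, ⟨g, hg, hg0⟩⟩ := hc
      have := h _ ⟨f, hf, g, hg, rfl⟩
      simp only [map_mul, mul_eq_zero] at this
      tauto

/-- The Zariski topology on the set of `K`-points `ℙ(K^σ)` of projective space. -/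
instance zariskiTopologicalSpace {K σ : Type*} [Field K] :
    TopologicalSpace (Projectivization K (σ → K)) :=
  TopologicalSpace.ofClosed {Z | IsZariskiClosed Z}
    ⟨{1}, by
      rintro f rfl
      exact ⟨0, MvPolynomial.isHomogeneous_one σ K⟩, by
      ext x
      simp [projZeroLocus]⟩
    (by
      intro A hA
      refine ⟨{f | (∃ m : ℕ, f.IsHomogeneous m) ∧ ∃ Z ∈ A, ∀ x ∈ Z,
        MvPolynomial.eval (Projectivization.rep x) f = 0}, fun f hf => hf.1, ?_⟩
      ext x
      constructor
      · rintro hx f ⟨-, Z, hZ, hf⟩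
        exact hf x (hx Z hZ)
      · intro hx Z hZ
        obtain ⟨S, hS, rfl⟩ := hA hZ
        exact fun f hf => hx f ⟨hS f hf, _, hZ, fun y hy => hy f hf⟩)
    (fun _ hY _ hZ => isZariskiClosed_union hY hZ)

/-! ### The Grassmannian in its Plücker embedding -/

/-- The Grassmannian of `ℓ`-dimensional linear subspaces of the space of row vectors `K^n`. -/
def Gr (K : Type*) [Field K] (ℓ n : ℕ) : Type _ :=
  {L : Submodule K (Fin n → K) // Module.finrank K L = ℓ}

/-- The vector of maximal minors of an `ℓ × n` matrix, indexed by the increasing sequences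
`i₁ < ⋯ < i_ℓ` of column indices. -/
def maximalMinors {K : Type*} [Field K] {ℓ n : ℕ} (M : Matrix (Fin ℓ) (Fin n) K) :
    (Fin ℓ ↪o Fin n) → K :=
  fun I => (M.submatrix id I).det

theorem maximalMinors_ne_zero {K : Type*} [Field K] {ℓ n : ℕ} (M : Matrix (Fin ℓ) (Fin n) K)
    (hM : LinearIndependent K M.row) : maximalMinors M ≠ 0 := by
  classical
  have hrank : M.rank = ℓ := by
    rw [hM.rank_matrix, Fintype.card_fin]
  have hspan : Submodule.span K (Set.range M.col) = ⊤ := by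
    apply Submodule.eq_top_of_finrank_eq
    rw [← Matrix.rank_eq_finrank_span_cols, hrank]
    simp
  obtain ⟨κ, a, ha, hsp, hli⟩ := exists_linearIndependent' K M.col
  rw [hspan] at hsp
  have : Finite κ := Finite.of_injective a ha
  have : Fintype κ := Fintype.ofFinite κ
  have hcard : Fintype.card κ = ℓ := by
    have h := finrank_span_eq_card hli
    rw [hsp] at h
    simpa using h.symm
  have hs : (Finset.univ.image a).card = ℓ := by
    rw [Finset.card_image_of_injective _ ha, Finset.card_univ, hcard]
  let I : Fin ℓ ↪o Fin n := (Finset.univ.image a).orderEmbOfFin hs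
  have hI : ∀ j, ∃ k, a k = I j := by
    intro j
    obtain ⟨k, -, hk⟩ := Finset.mem_image.1
      (Finset.orderEmbOfFin_mem (Finset.univ.image a) hs j)
    exact ⟨k, hk⟩
  choose b hb using hI
  have hbinj : Function.Injective b := by
    intro i j hij
    apply I.injective
    rw [← hb, ← hb, hij]
  have hli2 : LinearIndependent K (M.submatrix id I).col := by
    have h := hli.comp b hbinj
    have he : (M.submatrix id I).col = (M.col ∘ a) ∘ b := by
      funext j i
      change M i (I j) = M i (a (b j))
      rw [hb]
    rw [he]
    exact h
  intro h0
  have hdet : (M.submatrix id I).det = 0 := congrFun h0 I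
  have hu := Matrix.linearIndependent_cols_iff_isUnit.mp hli2
  rw [Matrix.isUnit_iff_isUnit_det, hdet] at hu
  exact not_isUnit_zero hu

/-- A matrix whose rows form a basis of `L`. -/
noncomputable def Gr.basisMatrix {K : Type*} [Field K] {ℓ n : ℕ} (L : Gr K ℓ n) :
    Matrix (Fin ℓ) (Fin n) K :=
  Matrix.of fun i => ((Module.finBasisOfFinrankEq K L.1 L.2 i : L.1) : Fin n → K)

theorem Gr.linearIndependent_basisMatrix {K : Type*} [Field K] {ℓ n : ℕ} (L : Gr K ℓ n) :
    LinearIndependent K L.basisMatrix.row :=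
  (Module.finBasisOfFinrankEq K L.1 L.2).linearIndependent.map' L.1.subtype L.1.ker_subtype

theorem Gr.span_basisMatrix {K : Type*} [Field K] {ℓ n : ℕ} (L : Gr K ℓ n) :
    Submodule.span K (Set.range L.basisMatrix.row) = L.1 := by
  have h : Set.range L.basisMatrix.row
      = L.1.subtype '' Set.range (Module.finBasisOfFinrankEq K L.1 L.2) := by
    rw [← Set.range_comp]
    rfl
  rw [h, Submodule.span_image, Module.Basis.span_eq, Submodule.map_top, Submodule.range_subtype]

/-- The Plücker embedding: `L` is sent to the class of the vector of maximal minors of a matrix with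
row space `L`. -/
noncomputable def plucker {K : Type*} [Field K] {ℓ n : ℕ} (L : Gr K ℓ n) :
    Projectivization K ((Fin ℓ ↪o Fin n) → K) :=
  Projectivization.mk K (maximalMinors L.basisMatrix)
    (maximalMinors_ne_zero _ L.linearIndependent_basisMatrix)

/-- The Plücker embedding can be computed from any matrix with row space `L`. -/
theorem plucker_eq_mk {K : Type*} [Field K] {ℓ n : ℕ} (L : Gr K ℓ n)
    (M : Matrix (Fin ℓ) (Fin n) K) (hM : LinearIndependent K M.row)
    (hL : Submodule.span K (Set.range M.row) = L.1) :
    plucker L = Projectivization.mk K (maximalMinors M) (maximalMinors_ne_zero M hM) := by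
  have hmem : ∀ i, L.basisMatrix.row i ∈ Submodule.span K (Set.range M.row) := by
    intro i
    rw [hL, ← L.span_basisMatrix]
    exact Submodule.subset_span ⟨i, rfl⟩
  have hc : ∀ i, ∃ c : Fin ℓ → K, ∑ j, c j • M.row j = L.basisMatrix.row i :=
    fun i => (Submodule.mem_span_range_iff_exists_fun K).1 (hmem i)
  choose c hc using hc
  have hB : L.basisMatrix = Matrix.of c * M := by
    ext i k
    have := congrFun (hc i) k
    rw [Matrix.mul_apply]
    simpa [Finset.sum_apply, Matrix.row] using this.symm
  unfold plucker
  rw [Projectivization.mk_eq_mk_iff']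
  refine ⟨(Matrix.of c).det, ?_⟩
  ext I
  have : L.basisMatrix.submatrix id I = Matrix.of c * M.submatrix id I := by
    rw [hB]
    rfl
  simp [maximalMinors, this, Matrix.det_mul]

/-- The variety `Gr(ℓ,n)^T = {L ∈ Gr(ℓ,n) : L T ⊆ L}`, as a set of points of the Plücker projective
space. The matrix `T` acts on row vectors from the right. -/
def fixedLocus {K : Type*} [Field K] (ℓ : ℕ) {n : ℕ} (T : Matrix (Fin n) (Fin n) K) :
    Set (Projectivization K ((Fin ℓ ↪o Fin n) → K)) :=
  plucker '' {L : Gr K ℓ n | ∀ v ∈ L.1, Matrix.vecMul v T ∈ L.1}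

/-! ### Nilpotent matrices in Jordan form -/

open Classical in
/-- The nilpotent `n × n` matrix `T_λ` in Jordan form, whose blocks have sizes
`λ₁ ≥ λ₂ ≥ ⋯ ≥ λ_s`. With rows and columns numbered from 1, it has an entry 1 at the positions
`(j, j + 1)` with `j` not a partial sum `λ₁ + ⋯ + λ_k`, and entries 0 elsewhere.
(Here `i : Fin n` is the row number `i + 1`.) -/
noncomputable def jordanNilpotent (K : Type*) [Field K] {n : ℕ} (lam : n.Partition) :
    Matrix (Fin n) (Fin n) K :=
  Matrix.of fun i j =>
    if (j : ℕ) = i + 1 ∧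
        ∀ k : ℕ, (i : ℕ) + 1 ≠ ((lam.parts.sort (fun a b => a ≥ b)).take k).sum
    then 1 else 0

/-- Rectangular partitions `(r, r, …, r)` with `d` parts, where `d, r ≥ 2`. -/
def IsRectangular {n : ℕ} (lam : n.Partition) : Prop :=
  ∃ d r : ℕ, 2 ≤ d ∧ 2 ≤ r ∧ lam.parts = Multiset.replicate d r

/-!
By the structure theory of modules over `K[X]`, every stable subspace is obtained from a system of
Jordan chains of length `r` by deleting the first `a i` vectors of the `i`-th chain. If
`0 < a i ≤ a j < r` with `i ≠ j`, this subspace `L` is the member `c = 0` of a family of stable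
subspaces depending polynomially on `c`: the first remaining vector `y` of the `j`-th chain is
replaced by `y + c • x`, where `x` is the last deleted vector of the `i`-th chain. For `c ≠ 0` the
type of the member has `a i - 1` and `a j + 1` in place of `a i` and `a j`, and the sum
`∑ i, a i * (r - a i)` has dropped by concavity. Hence `L` lies in the closure of the subspaces with
at most one partly deleted chain. The dimension determines the type of these up to order, so they
are row spaces of one matrix of polynomials and form a preirreducible set.
-/

theorem eval_smul_of_isHomogeneous {R σ : Type*} [CommSemiring R] {f : MvPolynomial σ R} {m : ℕ}
    (hf : f.IsHomogeneous m) (c : R) (v : σ → R) :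
    MvPolynomial.eval (c • v) f = c ^ m * MvPolynomial.eval v f := by
  rw [MvPolynomial.eval_eq, MvPolynomial.eval_eq, Finset.mul_sum]
  refine Finset.sum_congr rfl fun s hs => ?_
  have hdeg : ∑ i ∈ s.support, s i = m := by
    rw [← Finsupp.degree_apply, Finsupp.degree_eq_weight_one]
    exact hf (MvPolynomial.mem_support_iff.1 hs)
  simp only [Pi.smul_apply, smul_eq_mul, mul_pow, Finset.prod_mul_distrib,
    Finset.prod_pow_eq_pow_sum, hdeg, mul_left_comm]

theorem eval_bind₁ {R σ ι : Type*} [CommSemiring R] (v : σ → R) (φ : ι → MvPolynomial σ R)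
    (f : MvPolynomial ι R) :
    MvPolynomial.eval v (MvPolynomial.bind₁ φ f) =
      MvPolynomial.eval (fun i => MvPolynomial.eval v (φ i)) f :=
  MvPolynomial.eval₂Hom_bind₁ (RingHom.id R) v φ f

section ProjectiveSpace

variable {K σ ι : Type*} [Field K]

theorem eval_rep_mk_eq_zero_iff {f : MvPolynomial σ K} {m : ℕ} (hf : f.IsHomogeneous m)
    {v : σ → K} (hv : v ≠ 0) :
    MvPolynomial.eval (Projectivization.mk K v hv).rep f = 0 ↔ MvPolynomial.eval v f = 0 := by
  obtain ⟨c, hc⟩ := Projectivization.exists_smul_eq_mk_rep K v hv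
  rw [← hc, Units.smul_def, eval_smul_of_isHomogeneous hf]
  simp

theorem isClosed_iff_isZariskiClosed {Z : Set (Projectivization K (σ → K))} :
    IsClosed Z ↔ IsZariskiClosed Z := by
  rw [← isOpen_compl_iff]
  change IsZariskiClosed Zᶜᶜ ↔ _
  rw [compl_compl]

theorem exists_eval_ne_zero_of_mk_notMem {Z : Set (Projectivization K (σ → K))} (hZ : IsClosed Z)
    {v : σ → K} {hv : v ≠ 0} (hvZ : Projectivization.mk K v hv ∉ Z) :
    ∃ f : MvPolynomial σ K, MvPolynomial.eval v f ≠ 0 ∧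
      ∀ (w : σ → K) (hw : w ≠ 0), Projectivization.mk K w hw ∈ Z → MvPolynomial.eval w f = 0 := by
  obtain ⟨S, hS, rfl⟩ := isClosed_iff_isZariskiClosed.1 hZ
  simp only [projZeroLocus, Set.mem_ofPred_eq, not_forall] at hvZ ⊢
  obtain ⟨f, hfS, hf⟩ := hvZ
  obtain ⟨m, hm⟩ := hS f hfS
  rw [eval_rep_mk_eq_zero_iff hm] at hf
  exact ⟨f, hf, fun w hw h => (eval_rep_mk_eq_zero_iff hm hw).1 (h f hfS)⟩

/-- The points of projective space whose homogeneous coordinates are the values of the vector of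
polynomials `φ` at some `v`. The parameters `v` at which all coordinates vanish are discarded. -/
def polynomialImage (φ : ι → MvPolynomial σ K) : Set (Projectivization K (ι → K)) :=
  {x | ∃ (v : σ → K) (h : (fun i => MvPolynomial.eval v (φ i)) ≠ 0), Projectivization.mk K _ h = x}

variable [Infinite K]

/- If some value were missed by `Z`, a polynomial `f` vanishing on `Z` would pull back to a nonzero
polynomial; multiplying it by `g` and by a nonzero coordinate of `φ` produces a nonzero polynomial
vanishing everywhere. -/
theorem polynomialImage_subset_of_isClosed {Z : Set (Projectivization K (ι → K))} (hZ : IsClosed Z)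
    {φ : ι → MvPolynomial σ K} {g : MvPolynomial σ K} (hg : g ≠ 0)
    (hφ : ∀ v, MvPolynomial.eval v g ≠ 0 →
      ∀ h : (fun i => MvPolynomial.eval v (φ i)) ≠ 0, Projectivization.mk K _ h ∈ Z) :
    polynomialImage φ ⊆ Z := by
  rintro _ ⟨v, hv, rfl⟩
  by_contra hvZ
  obtain ⟨f, hfv, hfZ⟩ := exists_eval_ne_zero_of_mk_notMem hZ hvZ
  obtain ⟨i, hi⟩ := Function.ne_iff.1 hv
  have hf₀ : MvPolynomial.bind₁ φ f ≠ 0 := fun h => hfv (by rw [← eval_bind₁, h, map_zero])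
  have hφ₀ : φ i ≠ 0 := fun h => hi (by simp [h])
  refine mul_ne_zero (mul_ne_zero hg hφ₀) hf₀ (MvPolynomial.funext fun w => ?_)
  rw [map_mul, map_mul, map_zero, eval_bind₁, mul_eq_zero, or_iff_not_imp_left]
  intro hw
  have hwφ : (fun i => MvPolynomial.eval w (φ i)) ≠ 0 :=
    fun h => right_ne_zero_of_mul hw (congrFun h i)
  exact hfZ _ hwφ (hφ w (left_ne_zero_of_mul hw) hwφ)

theorem isPreirreducible_polynomialImage (φ : ι → MvPolynomial σ K) :
    IsPreirreducible (polynomialImage φ) := by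
  rw [isPreirreducible_iff_isClosed_union_isClosed]
  intro Z₁ Z₂ hZ₁ hZ₂ hsub
  rw [or_iff_not_imp_left, Set.not_subset]
  rintro ⟨_, ⟨v, hv, rfl⟩, hvZ₁⟩
  obtain ⟨f, hfv, hfZ₁⟩ := exists_eval_ne_zero_of_mk_notMem hZ₁ hvZ₁
  have hf₀ : MvPolynomial.bind₁ φ f ≠ 0 := fun h => hfv (by rw [← eval_bind₁, h, map_zero])
  refine polynomialImage_subset_of_isClosed hZ₂ hf₀ fun w hw hwφ => ?_
  rw [eval_bind₁] at hw
  exact (hsub ⟨w, hwφ, rfl⟩).resolve_left fun hwZ₁ => hw (hfZ₁ _ hwφ hwZ₁)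

end ProjectiveSpace

section RowSpace

variable {K : Type*} [Field K] {ℓ n : ℕ}

theorem linearIndependent_row_of_maximalMinors_ne_zero {M : Matrix (Fin ℓ) (Fin n) K}
    (h : maximalMinors M ≠ 0) : LinearIndependent K M.row := by
  obtain ⟨I, hI⟩ := Function.ne_iff.1 h
  have hu : LinearIndependent K (M.submatrix id I).row :=
    Matrix.linearIndependent_rows_iff_isUnit.2
      ((Matrix.isUnit_iff_isUnit_det _).2 (isUnit_iff_ne_zero.2 hI))
  exact LinearIndependent.of_comp (LinearMap.funLeft K K I) hu

theorem plucker_eq_mk_of_span {L : Gr K ℓ n} {M : Matrix (Fin ℓ) (Fin n) K}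
    (hL : Submodule.span K (Set.range M.row) = L.1) :
    ∃ h : maximalMinors M ≠ 0, plucker L = Projectivization.mk K (maximalMinors M) h := by
  have hM : LinearIndependent K M.row := by
    rw [linearIndependent_iff_card_eq_finrank_span, Set.finrank, hL, L.2, Fintype.card_fin]
  exact ⟨maximalMinors_ne_zero M hM, plucker_eq_mk L M hM hL⟩

theorem exists_plucker_eq_mk {M : Matrix (Fin ℓ) (Fin n) K} (h : maximalMinors M ≠ 0) :
    ∃ L : Gr K ℓ n, Submodule.span K (Set.range M.row) = L.1 ∧
      plucker L = Projectivization.mk K (maximalMinors M) h := by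
  have hM := linearIndependent_row_of_maximalMinors_ne_zero h
  exact ⟨⟨_, (finrank_span_eq_card hM).trans (Fintype.card_fin ℓ)⟩, rfl, plucker_eq_mk _ _ hM rfl⟩

variable {σ κ : Type*}

/-- The points of the Grassmannian that are row spaces of the values of a matrix of polynomials. -/
def rowSpaceLocus (ℓ : ℕ) (A : Matrix κ (Fin n) (MvPolynomial σ K)) :
    Set (Projectivization K ((Fin ℓ ↪o Fin n) → K)) :=
  plucker '' {L : Gr K ℓ n |
    ∃ v, Submodule.span K (Set.range (A.map (MvPolynomial.eval v)).row) = L.1}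

/-- The maximal minors of a matrix of polynomials whose rows are numbered by `s`. -/
noncomputable def polynomialMinors (A : Matrix κ (Fin n) (MvPolynomial σ K)) (s : Fin ℓ ≃ κ) :
    (Fin ℓ ↪o Fin n) → MvPolynomial σ K :=
  fun I => (A.submatrix s I).det

theorem eval_polynomialMinors (A : Matrix κ (Fin n) (MvPolynomial σ K)) (s : Fin ℓ ≃ κ)
    (v : σ → K) : (fun I => MvPolynomial.eval v (polynomialMinors A s I)) =
      maximalMinors ((A.map (MvPolynomial.eval v)).submatrix s id) := by
  ext I
  simp only [polynomialMinors, maximalMinors, RingHom.map_det]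
  rfl

theorem range_row_submatrix {R m κ' : Type*} (M : Matrix κ m R) (s : κ' ≃ κ) :
    Set.range (M.submatrix s id).row = Set.range M.row :=
  s.surjective.range_comp M.row

theorem rowSpaceLocus_eq_polynomialImage (A : Matrix κ (Fin n) (MvPolynomial σ K))
    (s : Fin ℓ ≃ κ) : rowSpaceLocus ℓ A = polynomialImage (polynomialMinors A s) := by
  ext x
  simp only [rowSpaceLocus, polynomialImage, eval_polynomialMinors, Set.mem_image,
    Set.mem_ofPred_eq]
  constructor
  · rintro ⟨L, ⟨v, hv⟩, rfl⟩
    rw [← range_row_submatrix _ s] at hv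
    obtain ⟨h, hL⟩ := plucker_eq_mk_of_span hv
    exact ⟨v, h, hL.symm⟩
  · rintro ⟨v, h, rfl⟩
    obtain ⟨L, hv, hL⟩ := exists_plucker_eq_mk h
    exact ⟨L, ⟨v, by rwa [range_row_submatrix] at hv⟩, hL⟩

variable [Infinite K] [Fintype κ]

theorem isPreirreducible_rowSpaceLocus (A : Matrix κ (Fin n) (MvPolynomial σ K))
    (hκ : Fintype.card κ = ℓ) : IsPreirreducible (rowSpaceLocus ℓ A) := by
  rw [rowSpaceLocus_eq_polynomialImage A (Fintype.equivFinOfCardEq hκ).symm]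
  exact isPreirreducible_polynomialImage _

theorem rowSpaceLocus_subset_of_isClosed {Z : Set (Projectivization K ((Fin ℓ ↪o Fin n) → K))}
    (hZ : IsClosed Z) (hκ : Fintype.card κ = ℓ) {A : Matrix κ (Fin n) (MvPolynomial σ K)}
    {g : MvPolynomial σ K} (hg : g ≠ 0)
    (hA : ∀ v, MvPolynomial.eval v g ≠ 0 → ∀ L : Gr K ℓ n,
      Submodule.span K (Set.range (A.map (MvPolynomial.eval v)).row) = L.1 → plucker L ∈ Z) :
    rowSpaceLocus ℓ A ⊆ Z := by
  let s := (Fintype.equivFinOfCardEq hκ).symm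
  rw [rowSpaceLocus_eq_polynomialImage A s]
  refine polynomialImage_subset_of_isClosed hZ hg fun v hv h => ?_
  simp only [eval_polynomialMinors] at h ⊢
  obtain ⟨L, hL, hLv⟩ := exists_plucker_eq_mk h
  rw [range_row_submatrix] at hL
  exact hLv ▸ hA v hv L hL

theorem plucker_mem_of_line {Z : Set (Projectivization K ((Fin ℓ ↪o Fin n) → K))}
    (hZ : IsClosed Z) (hκ : Fintype.card κ = ℓ) {u w : κ → Fin n → K} {L : Gr K ℓ n}
    (hL : Submodule.span K (Set.range u) = L.1)
    (hc : ∀ c : K, c ≠ 0 → ∀ L' : Gr K ℓ n,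
      Submodule.span K (Set.range (u + c • w)) = L'.1 → plucker L' ∈ Z) :
    plucker L ∈ Z := by
  let A : Matrix κ (Fin n) (MvPolynomial Unit K) := Matrix.of fun p k =>
    MvPolynomial.C (u p k) + MvPolynomial.X () * MvPolynomial.C (w p k)
  have hA (v : Unit → K) : (A.map (MvPolynomial.eval v)).row = u + v () • w := by
    ext p k
    simp [A, Matrix.row]
  have hAZ : rowSpaceLocus ℓ A ⊆ Z := by
    refine rowSpaceLocus_subset_of_isClosed hZ hκ (MvPolynomial.X_ne_zero ()) fun v hv L' hL' => ?_
    rw [MvPolynomial.eval_X] at hv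
    exact hc (v ()) hv L' (hA v ▸ hL')
  exact hAZ ⟨L, ⟨0, by rw [hA, ← hL, Pi.zero_apply, zero_smul, add_zero]⟩, rfl⟩

end RowSpace

section ElementaryDivisors

variable {R M ι : Type*} [CommRing R] [IsDomain R] [IsPrincipalIdealRing R] [AddCommGroup M]
  [Module R M] [Finite ι] {p : R} {r : ℕ} {N : Submodule R M}

theorem exists_basis_span_smul_eq (b : Module.Basis ι R M) {c : R} (hc : c ≠ 0)
    (hN : ∀ x, c • x ∈ N) :
    ∃ (b' : Module.Basis ι R M) (d : ι → R), (∀ i, d i ∣ c) ∧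
      Submodule.span R (Set.range fun i => d i • b' i) = N := by
  obtain ⟨m, snf⟩ := N.smithNormalForm b
  have hsurj : Function.Surjective snf.f := by
    intro i
    by_contra hi
    have h := snf.repr_eq_zero_of_notMem_range ⟨_, hN (snf.bM i)⟩ hi
    simp [hc] at h
  let s : Fin m ≃ ι := Equiv.ofBijective snf.f ⟨snf.f.injective, hsurj⟩
  refine ⟨snf.bM, snf.a ∘ s.symm, fun i => ?_, ?_⟩
  · obtain ⟨k, rfl⟩ := s.surjective i
    have h := snf.repr_apply_embedding_eq_repr_smul ⟨_, hN (snf.bM (s k))⟩ (i := k)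
    have hk : snf.f k = s k := rfl
    simp only [map_smul, Finsupp.smul_apply, smul_eq_mul, hk, Module.Basis.repr_self,
      Finsupp.single_eq_same, mul_one] at h
    exact ⟨_, by simpa using h⟩
  · have hbN : (fun i => (snf.a ∘ s.symm) i • snf.bM i) ∘ s = N.subtype ∘ snf.bN := by
      funext k
      change snf.a (s.symm (s k)) • snf.bM (snf.f k) = snf.bN k
      rw [s.symm_apply_apply, snf.snf]
    rw [← s.surjective.range_comp, hbN, Set.range_comp, Submodule.span_image, snf.bN.span_eq,
      Submodule.map_subtype_top]

theorem exists_basis_span_prime_pow_smul_eq (b : Module.Basis ι R M) (hp : Prime p)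
    (hN : ∀ x, p ^ r • x ∈ N) :
    ∃ (b' : Module.Basis ι R M) (a : ι → ℕ),
      Submodule.span R (Set.range fun i => p ^ a i • b' i) = N := by
  obtain ⟨b', d, hd, rfl⟩ := exists_basis_span_smul_eq b (pow_ne_zero r hp.ne_zero) hN
  have h (i) : ∃ (k : ℕ) (u : Rˣ), p ^ k * u = d i := by
    obtain ⟨k, -, hk⟩ := (dvd_prime_pow hp r).1 (hd i)
    exact ⟨k, hk.symm⟩
  choose a u hu using h
  refine ⟨b'.unitsSMul u, a, ?_⟩
  simp only [Module.Basis.unitsSMul_apply, Units.smul_def, smul_smul, hu]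

theorem exists_span_prime_pow_smul_eq {e₀ : ι → M} (he₀ : Submodule.span R (Set.range e₀) = ⊤)
    (hp : Prime p) (hN : ∀ x, p ^ r • x ∈ N) :
    ∃ (e : ι → M) (a : ι → ℕ), Submodule.span R (Set.range e) = ⊤ ∧
      Submodule.span R (Set.range fun i => p ^ a i • e i) = N := by
  have := Fintype.ofFinite ι
  let π := Fintype.linearCombination R e₀
  have hπ : LinearMap.range π = ⊤ := (Fintype.range_linearCombination R e₀).trans he₀
  obtain ⟨b, a, hb⟩ := exists_basis_span_prime_pow_smul_eq (N := N.comap π)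
    (Pi.basisFun R ι) hp (r := r) fun x => by simpa using hN (π x)
  refine ⟨π ∘ b, a, ?_, ?_⟩
  · rw [Set.range_comp, Submodule.span_image, b.span_eq, Submodule.map_top, hπ]
  · rw [← Submodule.map_comap_eq_of_surjective (LinearMap.range_eq_top.1 hπ) N, ← hb,
      Submodule.map_span, ← Set.range_comp]
    simp [Function.comp_def]

end ElementaryDivisors

section TruncSpan

/-- The span of the vectors `τ ^ k (e i)` with `a i ≤ k`: every chain `e i, τ (e i), τ² (e i), …` is
truncated by deleting its first `a i` vectors. -/
def truncSpan {K V ι : Type*} [Semiring K] [AddCommMonoid V] [Module K V] (τ : Module.End K V)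
    (e : ι → V) (a : ι → ℕ) : Submodule K V :=
  Submodule.span K {x | ∃ i k, a i ≤ k ∧ (τ ^ k) (e i) = x}

variable {K V ι : Type*} [CommSemiring K] [AddCommMonoid V] [Module K V] {τ : Module.End K V}
  {e : ι → V} {a : ι → ℕ} {r : ℕ}

theorem pow_apply_mem_truncSpan {i : ι} {k : ℕ} (h : a i ≤ k) : (τ ^ k) (e i) ∈ truncSpan τ e a :=
  Submodule.subset_span ⟨i, k, h, rfl⟩

theorem truncSpan_le_iff {W : Submodule K V} :
    truncSpan τ e a ≤ W ↔ ∀ i k, a i ≤ k → (τ ^ k) (e i) ∈ W := by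
  rw [truncSpan, Submodule.span_le]
  constructor
  · exact fun h i k hk => h ⟨i, k, hk, rfl⟩
  · rintro h _ ⟨i, k, hk, rfl⟩
    exact h i k hk

theorem truncSpan_antitone : Antitone (truncSpan τ e) := fun _ _ h =>
  truncSpan_le_iff.2 fun i _ hk => pow_apply_mem_truncSpan ((h i).trans hk)

theorem truncSpan_mem_invtSubmodule : truncSpan τ e a ∈ τ.invtSubmodule :=
  truncSpan_le_iff.2 fun i k hk => by
    rw [Submodule.mem_comap, ← Module.End.mul_apply, ← pow_succ']
    exact pow_apply_mem_truncSpan (hk.trans k.le_succ)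

theorem truncSpan_comp_equiv {κ : Type*} (s : κ ≃ ι) :
    truncSpan τ (e ∘ s) (a ∘ s) = truncSpan τ e a := by
  refine congrArg (Submodule.span K) (Set.ext fun x => ?_)
  exact s.exists_congr_left.trans (by simp)

/-- The pairs `(i, k)` with `a i ≤ k < r`. They index the vectors `τ ^ k (e i)` that span
`truncSpan τ e a` when `τ ^ r = 0`. -/
abbrev TruncIndex {ι : Type*} (r : ℕ) (a : ι → ℕ) : Type _ :=
  {p : ι × Fin r // a p.1 ≤ p.2}

/-- The spanning family `τ ^ k (e i)`, `a i ≤ k < r`, of `truncSpan τ e a` when `τ ^ r = 0`. -/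
def truncFamily (τ : Module.End K V) (r : ℕ) (e : ι → V) (a : ι → ℕ) (p : TruncIndex r a) : V :=
  (τ ^ (p.1.2 : ℕ)) (e p.1.1)

theorem truncSpan_eq_span_range (hτ : τ ^ r = 0) :
    truncSpan τ e a = Submodule.span K (Set.range (truncFamily τ r e a)) := by
  apply le_antisymm
  · refine truncSpan_le_iff.2 fun i k hk => ?_
    by_cases hkr : k < r
    · exact Submodule.subset_span ⟨⟨(i, ⟨k, hkr⟩), hk⟩, rfl⟩
    · rw [pow_eq_zero_of_le (not_lt.1 hkr) hτ, LinearMap.zero_apply]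
      exact zero_mem _
  · rw [Submodule.span_le]
    rintro _ ⟨p, rfl⟩
    exact pow_apply_mem_truncSpan p.2

open Module Polynomial in
theorem mem_truncSpan_iff {x : V} :
    x ∈ truncSpan τ e a ↔
      AEval'.of τ x ∈ Submodule.span K[X]
        (Set.range fun i => (X : K[X]) ^ a i • AEval'.of τ (e i)) := by
  constructor
  · suffices h : truncSpan τ e a ≤ ((Submodule.span K[X] (Set.range fun i =>
        (X : K[X]) ^ a i • AEval'.of τ (e i))).restrictScalars K).comap (AEval'.of τ).toLinearMap
      from fun hx => h hx
    refine truncSpan_le_iff.2 fun i k hk => ?_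
    change AEval'.of τ ((τ ^ k) (e i)) ∈ Submodule.span K[X] _
    rw [← Module.End.smul_def, ← AEval'.X_pow_smul_of, ← Nat.sub_add_cancel hk, pow_add, mul_smul]
    exact Submodule.smul_mem _ _ (Submodule.subset_span ⟨i, rfl⟩)
  · intro hx
    suffices h : Submodule.span K[X] (Set.range fun i => (X : K[X]) ^ a i • AEval'.of τ (e i)) ≤
        AEval.mapSubmodule K V τ ⟨truncSpan τ e a, truncSpan_mem_invtSubmodule (τ := τ)⟩ by
      simpa using h hx
    rw [Submodule.span_le]
    rintro _ ⟨i, rfl⟩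
    simp only [SetLike.mem_coe, AEval.mem_mapSubmodule_apply, AEval'.X_pow_smul_of,
      LinearEquiv.symm_apply_apply]
    exact pow_apply_mem_truncSpan le_rfl

end TruncSpan

open Module Polynomial in
theorem exists_eq_truncSpan {K V ι : Type*} [Field K] [AddCommGroup V] [Module K V] [Finite ι]
    {τ : Module.End K V} {r : ℕ} (hτ : τ ^ r = 0) {e₀ : ι → V} (he₀ : truncSpan τ e₀ 0 = ⊤)
    {L : Submodule K V} (hL : L ∈ τ.invtSubmodule) :
    ∃ (e : ι → V) (a : ι → ℕ), truncSpan τ e 0 = ⊤ ∧ truncSpan τ e a = L := by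
  have hspan : Submodule.span K[X] (Set.range fun i => AEval'.of τ (e₀ i)) = ⊤ := by
    refine eq_top_iff.2 fun x _ => ?_
    have hx : (AEval'.of τ).symm x ∈ truncSpan τ e₀ 0 := he₀ ▸ Submodule.mem_top
    simpa only [mem_truncSpan_iff, LinearEquiv.apply_symm_apply, Pi.zero_apply, pow_zero, one_smul]
      using hx
  have htorsion (x : AEval' τ) : (X : K[X]) ^ r • x ∈ AEval.mapSubmodule K V τ ⟨L, hL⟩ := by
    obtain ⟨v, rfl⟩ := (AEval'.of τ).surjective x
    rw [AEval'.X_pow_smul_of, hτ, zero_smul, map_zero]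
    exact zero_mem _
  obtain ⟨e, a, he, ha⟩ := exists_span_prime_pow_smul_eq hspan prime_X htorsion
  refine ⟨fun i => (AEval'.of τ).symm (e i), a, eq_top_iff.2 fun x _ => ?_,
    Submodule.ext fun x => ?_⟩
  · simp [mem_truncSpan_iff, he]
  · simp [mem_truncSpan_iff, ha]

section JordanFrame

variable {K V ι : Type*} [Field K] [AddCommGroup V] [Module K V] [Fintype ι]
  {τ : Module.End K V} {e : ι → V} {a : ι → ℕ} {r : ℕ}

/-- The vectors `e i` generate `V` as a `K[τ]`-module, where `τ ^ r = 0` and `dim V = |ι| * r`. Then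
the vectors `τ ^ k (e i)` with `k < r` form a basis, by counting dimensions: `τ` has Jordan blocks
of the same size `r`, with chains starting at the vectors `e i`. -/
structure IsJordanFrame (τ : Module.End K V) (r : ℕ) (e : ι → V) : Prop where
  pow_eq_zero : τ ^ r = 0
  truncSpan_eq_top : truncSpan τ e 0 = ⊤
  finrank_eq : Module.finrank K V = Fintype.card ι * r

theorem card_truncIndex (r : ℕ) (a : ι → ℕ) : Fintype.card (TruncIndex r a) = ∑ i, (r - a i) := by
  rw [Fintype.card_subtype, Finset.card_filter, Fintype.sum_prod_type]
  refine Finset.sum_congr rfl fun i _ => ?_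
  have hfilter : {k ∈ Finset.range r | a i ≤ k} = Finset.Ico (a i) r := by
    ext k
    simp [and_comm]
  rw [Fin.sum_univ_eq_sum_range (fun k => if a i ≤ k then 1 else 0) r, ← Finset.card_filter,
    hfilter, Nat.card_Ico]

namespace IsJordanFrame

theorem linearIndependent [FiniteDimensional K V] (he : IsJordanFrame τ r e) :
    LinearIndependent K fun p : ι × Fin r => (τ ^ (p.2 : ℕ)) (e p.1) := by
  refine linearIndependent_of_top_le_span_of_card_eq_finrank ?_ (by simp [he.finrank_eq])
  rw [← he.truncSpan_eq_top, truncSpan_eq_span_range he.pow_eq_zero]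
  refine Submodule.span_mono ?_
  rintro _ ⟨p, rfl⟩
  exact ⟨p.1, rfl⟩

theorem finrank_truncSpan [FiniteDimensional K V] (he : IsJordanFrame τ r e) (a : ι → ℕ) :
    Module.finrank K (truncSpan τ e a) = ∑ i, (r - a i) := by
  rw [truncSpan_eq_span_range he.pow_eq_zero, finrank_span_eq_card, card_truncIndex]
  exact he.linearIndependent.comp _ Subtype.val_injective

theorem comp_perm (he : IsJordanFrame τ r e) (s : Equiv.Perm ι) :
    IsJordanFrame τ r (e ∘ s) :=
  ⟨he.pow_eq_zero, (truncSpan_comp_equiv (a := 0) s).trans he.truncSpan_eq_top, he.finrank_eq⟩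

theorem exists_eq_truncSpan (he : IsJordanFrame τ r e) {L : Submodule K V}
    (hL : L ∈ τ.invtSubmodule) :
    ∃ (e' : ι → V) (a : ι → ℕ), IsJordanFrame τ r e' ∧ truncSpan τ e' a = L := by
  obtain ⟨e', a, he', ha⟩ := _root_.exists_eq_truncSpan he.pow_eq_zero he.truncSpan_eq_top hL
  exact ⟨e', a, ⟨he.pow_eq_zero, he', he.finrank_eq⟩, ha⟩

end IsJordanFrame

end JordanFrame

section KernelCriterion

open Module

variable {K V : Type*} [Field K] [AddCommGroup V] [Module K V] {τ : End K V} {r : ℕ}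

theorem ker_pow_le_of_ker_le_map {W : Submodule K V} (hW : W ∈ τ.invtSubmodule)
    (hker : LinearMap.ker τ ≤ W.map (τ ^ (r - 1))) {k : ℕ} (hk : k ≤ r) :
    LinearMap.ker (τ ^ k) ≤ W := by
  induction k with
  | zero => simp [End.one_eq_id]
  | succ k ih =>
    intro x hx
    have hxk : (τ ^ k) x ∈ LinearMap.ker τ := by
      rwa [LinearMap.mem_ker, ← End.mul_apply, ← pow_succ']
    obtain ⟨y, hy, hyx⟩ := hker hxk
    have hyW : (τ ^ (r - 1 - k)) y ∈ W := by
      rw [End.pow_apply]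
      exact Set.MapsTo.iterate hW _ hy
    have hsub : x - (τ ^ (r - 1 - k)) y ∈ LinearMap.ker (τ ^ k) := by
      rw [LinearMap.mem_ker, map_sub, ← End.mul_apply (τ ^ k), ← pow_add,
        Nat.add_sub_cancel' (by omega), hyx, sub_self]
    exact (W.sub_mem_iff_left hyW).1 (ih (by omega) hsub)

theorem finrank_map_add_finrank_ker [FiniteDimensional K V] {W : Submodule K V}
    (hW : LinearMap.ker τ ≤ W) :
    finrank K (W.map τ) + finrank K (LinearMap.ker τ) = finrank K W := by
  rw [← (τ.domRestrict W).finrank_range_add_finrank_ker, LinearMap.range_domRestrict,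
    LinearMap.ker_domRestrict, ← Submodule.submoduleOf,
    (Submodule.submoduleOfEquivOfLe hW).finrank_eq]

theorem finrank_range_pow_add_mul_finrank_ker [FiniteDimensional K V]
    (hker : LinearMap.ker τ ≤ LinearMap.range (τ ^ (r - 1))) {k : ℕ} (hk : k ≤ r) :
    finrank K (LinearMap.range (τ ^ k)) + k * finrank K (LinearMap.ker τ) = finrank K V := by
  induction k with
  | zero => rw [pow_zero, End.one_eq_id, LinearMap.range_id, finrank_top, zero_mul, add_zero]
  | succ k ih =>
    have hle : LinearMap.ker τ ≤ LinearMap.range (τ ^ k) := hker.trans <| by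
      rw [← Nat.add_sub_cancel' (show k ≤ r - 1 by omega), pow_add]
      exact LinearMap.range_comp_le_range _ _
    have hrange : LinearMap.range (τ ^ (k + 1)) = (LinearMap.range (τ ^ k)).map τ := by
      rw [pow_succ', Module.End.mul_eq_comp, LinearMap.range_comp]
    have hdim := finrank_map_add_finrank_ker hle
    rw [← ih (by omega), hrange, add_one_mul]
    omega

theorem exists_isJordanFrame [FiniteDimensional K V] (hτ : τ ^ r = 0)
    (hker : LinearMap.ker τ ≤ LinearMap.range (τ ^ (r - 1))) :
    ∃ e : Fin (finrank K (LinearMap.ker τ)) → V, IsJordanFrame τ r e := by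
  let b := finBasis K (LinearMap.ker τ)
  choose e he using fun i => hker (b i).2
  have hb : LinearMap.ker τ ≤ (truncSpan τ e 0).map (τ ^ (r - 1)) := by
    have hspan := congrArg (Submodule.map (LinearMap.ker τ).subtype) b.span_eq
    rw [Submodule.map_span, ← Set.range_comp, Submodule.map_subtype_top] at hspan
    refine hspan.ge.trans (Submodule.span_le.2 ?_)
    rintro _ ⟨i, rfl⟩
    exact ⟨e i, pow_apply_mem_truncSpan (k := 0) le_rfl, he i⟩
  refine ⟨e, hτ, top_le_iff.1 ?_, ?_⟩
  · have h := ker_pow_le_of_ker_le_map truncSpan_mem_invtSubmodule hb le_rfl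
    rwa [hτ, LinearMap.ker_zero] at h
  · have h := finrank_range_pow_add_mul_finrank_ker hker le_rfl
    rw [hτ, LinearMap.range_zero, finrank_bot, zero_add] at h
    rw [Fintype.card_fin, mul_comm, h]

end KernelCriterion

section GenericType

/-- At most one of the numbers `a i` lies strictly between `0` and `r`. If the `a i` are at most
`r`, then such truncations of chains of length `r` are those of a generic stable subspace. -/
def IsGenericType {ι : Type*} (r : ℕ) (a : ι → ℕ) : Prop :=
  (a ⁻¹' Set.Ioo 0 r).Subsingleton

theorem exists_le_of_not_isGenericType {ι : Type*} {r : ℕ} {a : ι → ℕ} (h : ¬ IsGenericType r a) :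
    ∃ i j, i ≠ j ∧ 0 < a i ∧ a i ≤ a j ∧ a j < r := by
  obtain ⟨i, hi, j, hj, hij⟩ := Set.not_subsingleton_iff.1 h
  rcases le_total (a i) (a j) with hle | hle
  · exact ⟨i, j, hij, hi.1, hle, hj.2⟩
  · exact ⟨j, i, hij.symm, hj.1, hle, hi.2⟩

/-- The type `r - min r (ℓ - i * r)`, where row `i` of length `r` lacks the boxes that remain empty
when `ℓ` boxes are put into the rows one after the other. -/
def rowFillingType (d r ℓ : ℕ) (i : Fin d) : ℕ :=
  r - (ℓ - i * r)

variable {d r ℓ : ℕ} {a : Fin d → ℕ}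

theorem sum_sub_rowFillingType (d r ℓ : ℕ) : ∑ i, (r - rowFillingType d r ℓ i) = min ℓ (d * r) := by
  simp only [rowFillingType]
  rw [Fin.sum_univ_eq_sum_range (fun i => r - (r - (ℓ - i * r))) d]
  induction d with
  | zero => simp
  | succ d ih =>
    rw [Finset.sum_range_succ, ih, Nat.succ_mul]
    omega

theorem mul_add_le_sum_sub {i : Fin d} (h : ∀ j < i, a j = 0) :
    i * r + (r - a i) ≤ ∑ j, (r - a j) := by
  calc i * r + (r - a i) = ∑ j ∈ Finset.Iio i, (r - a j) + (r - a i) := by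
        rw [Finset.sum_congr rfl fun j hj => by rw [h j (Finset.mem_Iio.1 hj)]]
        simp
    _ = ∑ j ∈ insert i (Finset.Iio i), (r - a j) := by
        rw [Finset.sum_insert (by simp), add_comm]
    _ ≤ ∑ j, (r - a j) := Finset.sum_le_sum_of_subset (Finset.subset_univ _)

theorem IsGenericType.rowFillingType_le (ha : IsGenericType r a) (hmono : Monotone a) :
    rowFillingType d r (∑ i, (r - a i)) ≤ a := by
  intro i
  change r - (∑ j, (r - a j) - i * r) ≤ a i
  rcases le_or_gt r (a i) with hi | hi
  · omega
  · have hzero : ∀ j < i, a j = 0 := by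
      intro j hj
      have hji := hmono hj.le
      by_contra hne
      exact hj.ne (ha ⟨Nat.pos_of_ne_zero hne, by omega⟩ ⟨by omega, hi⟩)
    have := mul_add_le_sum_sub (r := r) hzero
    omega

variable {K V : Type*} [Field K] [AddCommGroup V] [Module K V] [FiniteDimensional K V]
  {τ : Module.End K V} {e : Fin d → V}

theorem IsGenericType.exists_truncSpan_rowFillingType_eq (ha : IsGenericType r a)
    (he : IsJordanFrame τ r e) :
    ∃ e' : Fin d → V,
      truncSpan τ e' (rowFillingType d r (∑ i, (r - a i))) = truncSpan τ e a := by
  let s := Tuple.sort a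
  have hsum : ∑ i, (r - (a ∘ s) i) = ∑ i, (r - a i) := Equiv.sum_comp s fun i => r - a i
  have has : IsGenericType r (a ∘ s) := ha.preimage s.injective
  have hle := has.rowFillingType_le (Tuple.monotone_sort a)
  refine ⟨e ∘ s, (Submodule.eq_of_le_of_finrank_le ?_ ?_).symm⟩
  · rw [← truncSpan_comp_equiv s, ← hsum]
    exact truncSpan_antitone hle
  · rw [he.finrank_truncSpan, (he.comp_perm s).finrank_truncSpan, sum_sub_rowFillingType]
    exact min_le_left _ _

end GenericType

section Degeneration

/-- The type obtained by moving a box from row `j` to row `i`: the chain at `i` regains a vector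
and the chain at `j` loses one. -/
def moveBox {ι : Type*} [DecidableEq ι] (a : ι → ℕ) (i j : ι) : ι → ℕ :=
  Function.update (Function.update a i (a i - 1)) j (a j + 1)

variable {ι : Type*} [DecidableEq ι] {a : ι → ℕ} {i j : ι} {r : ℕ}

section MoveBox

variable [Fintype ι]

theorem sum_comp_moveBox (hij : i ≠ j) (g : ℕ → ℕ) :
    ∑ l, g (moveBox a i j l) + (g (a i) + g (a j)) =
      ∑ l, g (a l) + (g (a i - 1) + g (a j + 1)) := by
  have hterm (l : ι) : g (moveBox a i j l) +
      ((if l = i then g (a i) else 0) + (if l = j then g (a j) else 0)) =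
      g (a l) + ((if l = i then g (a i - 1) else 0) + (if l = j then g (a j + 1) else 0)) := by
    rcases eq_or_ne l j with rfl | hlj
    · simp [moveBox, hij.symm, add_comm]
    · rcases eq_or_ne l i with rfl | hli
      · simp [moveBox, hlj, add_comm]
      · simp [moveBox, hlj, hli]
  simpa [Finset.sum_add_distrib] using Finset.sum_congr rfl fun l (_ : l ∈ Finset.univ) => hterm l

theorem sum_sub_moveBox (hij : i ≠ j) (hi : 0 < a i) (hir : a i ≤ r) (hj : a j < r) :
    ∑ l, (r - moveBox a i j l) = ∑ l, (r - a l) := by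
  have h := sum_comp_moveBox (a := a) hij (r - ·)
  beta_reduce at h
  omega

theorem sum_mul_sub_moveBox_lt (hij : i ≠ j) (hi : 0 < a i) (hle : a i ≤ a j) (hj : a j < r) :
    ∑ l, moveBox a i j l * (r - moveBox a i j l) < ∑ l, a l * (r - a l) := by
  have hconcave : (a i - 1) * (r - (a i - 1)) + (a j + 1) * (r - (a j + 1)) <
      a i * (r - a i) + a j * (r - a j) := by
    have hir := hle.trans hj.le
    zify [hi, hir, hj.le, Nat.succ_le_of_lt hj, (Nat.sub_le _ 1).trans hir]
    nlinarith
  have h := sum_comp_moveBox (a := a) hij fun x => x * (r - x)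
  beta_reduce at h
  omega

end MoveBox

variable {K V : Type*} [Field K] [AddCommGroup V] [Module K V] {τ : Module.End K V} {e : ι → V}

theorem IsJordanFrame.update_smul_add [Fintype ι] (he : IsJordanFrame τ r e) (hij : i ≠ j) (m : ℕ)
    {c : K} (hc : c ≠ 0) :
    IsJordanFrame τ r (Function.update e i (c • e i + (τ ^ m) (e j))) := by
  set e' := Function.update e i (c • e i + (τ ^ m) (e j)) with he'
  have hmem (l k) : (τ ^ k) (e' l) ∈ truncSpan τ e' 0 := pow_apply_mem_truncSpan (Nat.zero_le k)
  have hmem_of_ne (l k) (hl : l ≠ i) : (τ ^ k) (e l) ∈ truncSpan τ e' 0 := by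
    simpa only [he', Function.update_of_ne hl] using hmem l k
  refine ⟨he.pow_eq_zero, top_le_iff.1 ?_, he.finrank_eq⟩
  rw [← he.truncSpan_eq_top]
  refine truncSpan_le_iff.2 fun l k _ => ?_
  rcases eq_or_ne l i with rfl | hl
  · have h := hmem l k
    rw [he', Function.update_self, map_add, map_smul, ← Module.End.mul_apply, ← pow_add, ← he',
      Submodule.add_mem_iff_left _ (hmem_of_ne j (k + m) hij.symm)] at h
    exact (Submodule.smul_mem_iff _ hc).1 h
  · exact hmem_of_ne l k hl

theorem truncSpan_update_moveBox_le (hτ : τ ^ r = 0) (hij : i ≠ j) (hi : 0 < a i)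
    (hle : a i ≤ a j) (hj : a j < r) (c : K) :
    truncSpan τ (Function.update e i (c • e i + (τ ^ (a j + 1 - a i)) (e j))) (moveBox a i j) ≤
      Submodule.span K (Set.range
        (truncFamily τ r e a + c • Pi.single (M := fun _ : TruncIndex r a => V)
          ⟨(j, ⟨a j, hj⟩), le_rfl⟩ ((τ ^ (a i - 1)) (e i)))) := by
  set W := Submodule.span K (Set.range
        (truncFamily τ r e a + c • Pi.single (M := fun _ : TruncIndex r a => V)
          ⟨(j, ⟨a j, hj⟩), le_rfl⟩ ((τ ^ (a i - 1)) (e i))))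
  have hmem_of_ne (l k) (hk : a l ≤ k) (hne : l = j → k ≠ a j) : (τ ^ k) (e l) ∈ W := by
    by_cases hkr : k < r
    · refine Submodule.subset_span ⟨⟨(l, ⟨k, hkr⟩), hk⟩, ?_⟩
      simp [truncFamily, not_and.2 hne]
    · rw [pow_eq_zero_of_le (not_lt.1 hkr) hτ]
      exact zero_mem _
  have hmem : c • (τ ^ (a i - 1)) (e i) + (τ ^ a j) (e j) ∈ W :=
    Submodule.subset_span ⟨⟨(j, ⟨a j, hj⟩), le_rfl⟩, by simp [truncFamily, add_comm]⟩
  refine truncSpan_le_iff.2 fun l k hk => ?_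
  rcases eq_or_ne l i with rfl | hli
  · rw [moveBox, Function.update_of_ne hij, Function.update_self] at hk
    rw [Function.update_self, map_add, map_smul, ← Module.End.mul_apply, ← pow_add]
    rcases hk.eq_or_lt with rfl | hk'
    · rwa [show a l - 1 + (a j + 1 - a l) = a j by omega]
    · exact W.add_mem (W.smul_mem _ (hmem_of_ne _ _ (by omega) fun h => absurd h hij))
        (hmem_of_ne _ _ (by omega) (by omega))
  · rw [Function.update_of_ne hli]
    rcases eq_or_ne l j with rfl | hlj
    · rw [moveBox, Function.update_self] at hk
      exact hmem_of_ne _ _ (by omega) (by omega)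
    · rw [moveBox, Function.update_of_ne hlj, Function.update_of_ne hli] at hk
      exact hmem_of_ne _ _ hk fun h => absurd h hlj

theorem IsJordanFrame.truncSpan_update_moveBox [Fintype ι] [FiniteDimensional K V]
    (he : IsJordanFrame τ r e) (hij : i ≠ j) (hi : 0 < a i) (hle : a i ≤ a j) (hj : a j < r)
    {c : K} (hc : c ≠ 0) :
    truncSpan τ (Function.update e i (c • e i + (τ ^ (a j + 1 - a i)) (e j))) (moveBox a i j) =
      Submodule.span K (Set.range
        (truncFamily τ r e a + c • Pi.single (M := fun _ : TruncIndex r a => V)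
          ⟨(j, ⟨a j, hj⟩), le_rfl⟩ ((τ ^ (a i - 1)) (e i)))) := by
  apply Submodule.eq_of_le_of_finrank_le
    (truncSpan_update_moveBox_le he.pow_eq_zero hij hi hle hj c)
  rw [(he.update_smul_add hij _ hc).finrank_truncSpan,
    sum_sub_moveBox hij hi (hle.trans hj.le) hj, ← card_truncIndex]
  exact finrank_range_le_card _

end Degeneration

theorem plucker_mem_of_forall_isGenericType {K ι : Type*} [Field K] [Infinite K] [Fintype ι]
    {n r ℓ : ℕ} {τ : Module.End K (Fin n → K)} {Z : Set (Projectivization K ((Fin ℓ ↪o Fin n) → K))}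
    (hZ : IsClosed Z)
    (hgen : ∀ (e : ι → Fin n → K) (a : ι → ℕ), IsJordanFrame τ r e → IsGenericType r a →
      ∀ L : Gr K ℓ n, truncSpan τ e a = L.1 → plucker L ∈ Z)
    {e : ι → Fin n → K} (he : IsJordanFrame τ r e) {a : ι → ℕ} {L : Gr K ℓ n}
    (hL : truncSpan τ e a = L.1) : plucker L ∈ Z := by
  classical
  induction hN : ∑ l, a l * (r - a l) using Nat.strong_induction_on generalizing e a L with
  | _ N ih =>
    by_cases hcase : IsGenericType r a
    · exact hgen e a he hcase L hL
    obtain ⟨i, j, hij, hi, hle, hj⟩ := exists_le_of_not_isGenericType hcase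
    have hcard : Fintype.card (TruncIndex r a) = ℓ := by
      rw [card_truncIndex, ← he.finrank_truncSpan, hL, L.2]
    refine plucker_mem_of_line hZ hcard ((truncSpan_eq_span_range he.pow_eq_zero).symm.trans hL)
      (w := Pi.single ⟨(j, ⟨a j, hj⟩), le_rfl⟩ ((τ ^ (a i - 1)) (e i))) fun c hc L' hL' => ?_
    rw [← he.truncSpan_update_moveBox hij hi hle hj hc] at hL'
    exact ih _ (hN ▸ sum_mul_sub_moveBox_lt hij hi hle hj) (he.update_smul_add hij _ hc) hL' rfl

section JordanNilpotent

variable (K : Type*) [Field K] {n d r : ℕ} {lam : n.Partition}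

theorem jordanNilpotent_map (F : Type*) [Field F] [Algebra K F] (lam : n.Partition) :
    (jordanNilpotent K lam).map (algebraMap K F) = jordanNilpotent F lam := by
  ext i j
  simp only [jordanNilpotent, Matrix.map_apply, Matrix.of_apply]
  split_ifs <;> simp

theorem eq_mul_of_parts_eq_replicate (h : lam.parts = Multiset.replicate d r) : n = d * r := by
  rw [← lam.parts_sum, h, Multiset.sum_replicate, smul_eq_mul]

theorem pos_of_parts_eq_replicate (h : lam.parts = Multiset.replicate d r) (hn : 0 < n) :
    0 < r :=
  Nat.pos_of_mul_pos_left (eq_mul_of_parts_eq_replicate h ▸ hn)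

theorem forall_ne_sum_take_sort_parts_iff (h : lam.parts = Multiset.replicate d r) {m : ℕ}
    (hm : m ≤ n) (hm' : 0 < m) :
    (∀ k, m ≠ ((lam.parts.sort (fun a b => a ≥ b)).take k).sum) ↔ ¬ r ∣ m := by
  have hsort : lam.parts.sort (fun a b => a ≥ b) = List.replicate d r := by
    refine List.eq_replicate_iff.2 ⟨by rw [Multiset.length_sort, h, Multiset.card_replicate], ?_⟩
    intro b hb
    rw [Multiset.mem_sort, h] at hb
    exact Multiset.eq_of_mem_replicate hb
  simp only [hsort, List.take_replicate, List.sum_replicate, smul_eq_mul]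
  constructor
  · rintro hk ⟨q, rfl⟩
    have hr := Nat.pos_of_mul_pos_right hm'
    rw [eq_mul_of_parts_eq_replicate h, mul_comm] at hm
    have hqd : q ≤ d := Nat.le_of_mul_le_mul_right hm hr
    exact hk q (by rw [min_eq_left hqd, mul_comm])
  · rintro hr k rfl
    exact hr (dvd_mul_left _ _)

variable {K}

theorem vecMul_jordanNilpotent (h : lam.parts = Multiset.replicate d r) (v : Fin n → K)
    (j : Fin n) :
    Matrix.vecMul v (jordanNilpotent K lam) j =
      if r ∣ (j : ℕ) then 0 else v ⟨j - 1, (Nat.sub_le _ _).trans_lt j.2⟩ := by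
  have hdvd (i : Fin n) :
      (∀ k, (i : ℕ) + 1 ≠ ((lam.parts.sort (fun a b => a ≥ b)).take k).sum) ↔ ¬ r ∣ (i : ℕ) + 1 :=
    forall_ne_sum_take_sort_parts_iff h i.2 (Nat.succ_pos _)
  simp only [Matrix.vecMul, dotProduct, jordanNilpotent, Matrix.of_apply, hdvd]
  split_ifs with hj
  · refine Finset.sum_eq_zero fun i _ => ?_
    rw [if_neg fun hi => hi.2 (by rwa [← hi.1]), mul_zero]
  · have hj0 : (j : ℕ) ≠ 0 := fun h0 => hj (h0 ▸ dvd_zero r)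
    rw [Finset.sum_eq_single ⟨j - 1, (Nat.sub_le _ _).trans_lt j.2⟩, if_pos, mul_one]
    · simpa only [Nat.sub_add_cancel (Nat.pos_of_ne_zero hj0), true_and] using hj
    · intro i _ hi
      rw [if_neg fun hij => hi (Fin.ext (by simp only; omega)), mul_zero]
    · simp

theorem sub_one_mod_of_mod_pos {m r : ℕ} (h : 0 < m % r) : (m - 1) % r = m % r - 1 := by
  rcases Nat.eq_zero_or_pos r with rfl | hr
  · simp only [Nat.mod_zero]
  · have hlt := Nat.mod_lt m hr
    have hm : m - 1 = m % r - 1 + r * (m / r) := by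
      have := Nat.mod_add_div m r
      omega
    rw [hm, Nat.add_mul_mod_self_left, Nat.mod_eq_of_lt (by omega)]

theorem vecMul_jordanNilpotent_pow (h : lam.parts = Multiset.replicate d r) (v : Fin n → K)
    (k : ℕ) (j : Fin n) :
    Matrix.vecMul v (jordanNilpotent K lam ^ k) j =
      if k ≤ j % r then v ⟨j - k, (Nat.sub_le _ _).trans_lt j.2⟩ else 0 := by
  induction k generalizing j with
  | zero => simp
  | succ k ih =>
    rw [pow_succ, ← Matrix.vecMul_vecMul, vecMul_jordanNilpotent h, ih]
    rcases Nat.eq_zero_or_pos (j % r) with hj | hj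
    · rw [if_pos (Nat.dvd_of_mod_eq_zero hj), if_neg (by omega)]
    · have hmod := sub_one_mod_of_mod_pos hj
      rw [if_neg fun hdvd => hj.ne' (Nat.mod_eq_zero_of_dvd hdvd)]
      simp only [hmod, Nat.sub_sub, add_comm 1 k]
      exact if_congr (by omega) rfl rfl

theorem jordanNilpotent_pow_eq_zero (h : lam.parts = Multiset.replicate d r) :
    jordanNilpotent K lam ^ r = 0 := by
  refine Matrix.ext_of_single_vecMul fun i => funext fun j => ?_
  rw [vecMul_jordanNilpotent_pow h, Matrix.vecMul_zero, Pi.zero_apply,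
    if_neg (Nat.mod_lt _ (pos_of_parts_eq_replicate h j.pos)).not_ge]

theorem exists_vecMul_jordanNilpotent_pow_eq (h : lam.parts = Multiset.replicate d r)
    {v : Fin n → K} (hv : Matrix.vecMul v (jordanNilpotent K lam) = 0) :
    ∃ w, Matrix.vecMul w (jordanNilpotent K lam ^ (r - 1)) = v := by
  refine ⟨fun i => if hi : i + (r - 1) < n then v ⟨i + (r - 1), hi⟩ else 0, funext fun j => ?_⟩
  rw [vecMul_jordanNilpotent_pow h]
  by_cases hj : r - 1 ≤ j % r
  · have hle := hj.trans (Nat.mod_le j r)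
    simp [hj, Nat.sub_add_cancel hle]
  · rw [if_neg hj]
    have hdvd : ¬ r ∣ (j : ℕ) + 1 := by
      have hr := pos_of_parts_eq_replicate h j.pos
      rw [← Nat.sub_add_cancel hr] at hj ⊢
      rw [Nat.dvd_iff_mod_eq_zero, Nat.succ_mod_succ_eq_zero_iff]
      exact fun hs => hj hs.ge
    have hlt : (j : ℕ) + 1 < n :=
      lt_of_le_of_ne j.2 fun hn => hdvd (by
        rw [hn, eq_mul_of_parts_eq_replicate h]
        exact dvd_mul_left r d)
    have hvj := congrFun hv ⟨j + 1, hlt⟩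
    rw [vecMul_jordanNilpotent h, if_neg hdvd] at hvj
    exact hvj.symm

end JordanNilpotent

section StableSubspaces

variable {K ι : Type*} [Field K] {n r ℓ : ℕ} {T : Matrix (Fin n) (Fin n) K}

theorem vecMulLinear_pow_apply (T : Matrix (Fin n) (Fin n) K) (k : ℕ) (x : Fin n → K) :
    (T.vecMulLinear ^ k) x = Matrix.vecMul x (T ^ k) := by
  induction k generalizing x with
  | zero => simp
  | succ k ih =>
    rw [pow_succ, Module.End.mul_apply, ih, Matrix.vecMulLinear_apply, Matrix.vecMul_vecMul,
      ← pow_succ']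

theorem vecMulLinear_pow_eq_zero (hT : T ^ r = 0) : T.vecMulLinear ^ r = 0 := by
  refine LinearMap.ext fun x => ?_
  rw [vecMulLinear_pow_apply, hT, Matrix.vecMul_zero, LinearMap.zero_apply]

/-- The matrix with the rows `x i * T ^ k`, `a i ≤ k < r`, where the `x i` are vectors of
indeterminates: the generic form of the subspaces `truncSpan T.vecMulLinear e a`. -/
noncomputable def genericChainMatrix (T : Matrix (Fin n) (Fin n) K) (r : ℕ) (a : ι → ℕ) :
    Matrix (TruncIndex r a) (Fin n) (MvPolynomial (ι × Fin n) K) :=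
  Matrix.of fun p => Matrix.vecMul (fun m => MvPolynomial.X (p.1.1, m))
    ((T ^ (p.1.2 : ℕ)).map MvPolynomial.C)

theorem span_row_map_eval_genericChainMatrix (hT : T ^ r = 0) (a : ι → ℕ) (v : ι × Fin n → K) :
    Submodule.span K (Set.range ((genericChainMatrix T r a).map (MvPolynomial.eval v)).row) =
      truncSpan T.vecMulLinear (fun i m => v (i, m)) a := by
  rw [truncSpan_eq_span_range (vecMulLinear_pow_eq_zero hT)]
  congr 2
  ext p m
  simp [genericChainMatrix, truncFamily, vecMulLinear_pow_apply, Matrix.vecMul, dotProduct]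

theorem rowSpaceLocus_genericChainMatrix (hT : T ^ r = 0) (a : ι → ℕ) :
    rowSpaceLocus ℓ (genericChainMatrix T r a) =
      plucker '' {L : Gr K ℓ n | ∃ e, truncSpan T.vecMulLinear e a = L.1} := by
  simp only [rowSpaceLocus, span_row_map_eval_genericChainMatrix hT]
  congr 1
  ext L
  exact (Equiv.curry ι (Fin n) K).exists_congr_left.trans Iff.rfl

theorem isPreirreducible_image_truncSpan [Infinite K] [Fintype ι] (hT : T ^ r = 0) {a : ι → ℕ}
    (ha : ∑ i, (r - a i) = ℓ) :
    IsPreirreducible (plucker '' {L : Gr K ℓ n | ∃ e, truncSpan T.vecMulLinear e a = L.1}) := by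
  rw [← rowSpaceLocus_genericChainMatrix hT]
  exact isPreirreducible_rowSpaceLocus _ ((card_truncIndex r a).trans ha)

theorem fixedLocus_subset_closure_image_truncSpan [Infinite K] {d : ℕ} {e₀ : Fin d → Fin n → K}
    (he₀ : IsJordanFrame T.vecMulLinear r e₀) :
    fixedLocus ℓ T ⊆ closure (plucker ''
      {L : Gr K ℓ n | ∃ e, truncSpan T.vecMulLinear e (rowFillingType d r ℓ) = L.1}) := by
  rintro _ ⟨L, hL, rfl⟩
  obtain ⟨e, a, he, ha⟩ := he₀.exists_eq_truncSpan (L := L.1) hL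
  refine plucker_mem_of_forall_isGenericType isClosed_closure (fun e a he ha L hL => ?_) he ha
  obtain ⟨e', he'⟩ := ha.exists_truncSpan_rowFillingType_eq he
  rw [← he.finrank_truncSpan, hL, L.2] at he'
  exact subset_closure ⟨L, ⟨e', he'⟩, rfl⟩

theorem mainTheorem2_general [Infinite K] (hT : T ^ r = 0)
    (hker : ∀ v, Matrix.vecMul v T = 0 → ∃ w, Matrix.vecMul w (T ^ (r - 1)) = v) (hℓ : ℓ ≤ n) :
    IsIrreducible (fixedLocus ℓ T) := by
  obtain ⟨d, e₀, he₀⟩ : ∃ (d : ℕ) (e₀ : Fin d → Fin n → K), IsJordanFrame T.vecMulLinear r e₀ :=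
    ⟨_, exists_isJordanFrame (vecMulLinear_pow_eq_zero hT) fun v hv => by
      simpa only [LinearMap.mem_range, vecMulLinear_pow_apply] using hker v hv⟩
  have hsum : ∑ i, (r - rowFillingType d r ℓ i) = ℓ := by
    have hdim := he₀.finrank_eq
    rw [Module.finrank_fin_fun, Fintype.card_fin] at hdim
    rw [sum_sub_rowFillingType, ← hdim, min_eq_left hℓ]
  set S := {L : Gr K ℓ n | ∃ e, truncSpan T.vecMulLinear e (rowFillingType d r ℓ) = L.1}
  have hsub : plucker '' S ⊆ fixedLocus ℓ T := Set.image_mono fun L ⟨e, he⟩ v hv => by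
    rw [← he] at hv ⊢
    exact truncSpan_mem_invtSubmodule hv
  have hclosure : closure (fixedLocus ℓ T) = closure (plucker '' S) :=
    (closure_minimal (fixedLocus_subset_closure_image_truncSpan he₀) isClosed_closure).antisymm
      (closure_mono hsub)
  refine ⟨.mono hsub ⟨_, ⟨_, (he₀.finrank_truncSpan _).trans hsum⟩, ⟨e₀, rfl⟩, rfl⟩, ?_⟩
  rw [← isPreirreducible_iff_closure, hclosure, isPreirreducible_iff_closure]
  exact isPreirreducible_image_truncSpan hT hsum

end StableSubspaces

/-- For a rectangular partition `λ` of `n` and `0 ≤ ℓ ≤ n`, the variety `Gr(ℓ,n)^{T_λ}` over a field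
`K` is irreducible: its set of geometric points is irreducible in the Zariski topology, and so is its
set of `K`-points if `K` is infinite. -/
theorem mainTheorem2 (K : Type*) [Field K] {n : ℕ} (lam : n.Partition) (hlam : IsRectangular lam)
    (ℓ : ℕ) (hℓ : ℓ ≤ n) :
    IsIrreducible (fixedLocus ℓ
      ((jordanNilpotent K lam).map (algebraMap K (AlgebraicClosure K)))) ∧
    (Infinite K → IsIrreducible (fixedLocus ℓ (jordanNilpotent K lam))) := by
  obtain ⟨d, r, -, -, h⟩ := hlam
  have hirred (F : Type _) [Field F] [Infinite F] :
      IsIrreducible (fixedLocus ℓ (jordanNilpotent F lam)) :=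
    mainTheorem2_general (jordanNilpotent_pow_eq_zero h)
      (fun _ => exists_vecMul_jordanNilpotent_pow_eq h) hℓ
  rw [jordanNilpotent_map]
  exact ⟨hirred _, fun _ => hirred K⟩
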